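/- **Setting.** Let $X=\mathbb{R}^n$ (any finite-dimensional real inner product space) and write $B_r(x)$ for open metric balls. Let $F:X\rightrightarrows X$ be a velocity multifunction (for a control system $\dot x=f(x,u)$, $u\in U$, it is $F(x)=\{f(x,u):u\in U\}$) such that * (SH1) every $F(x)$ is nonempty and convex, the graph $\{(x,v):v\in F(x)\}$ is closed, and for every compact $K\subset X$ there is $M>0$ with $\|v\|\le M$ for all $x\in K$, $v\in F(x)$; * (SH2) there are $\gamma,c>0$ with $\|v\|\le\gamma\|x\|+c$ for all $x\in X$, $v\in F(x)$; * (SH3) for every compact $K\subset X$ there is $k>0$ with $F(x)\subseteq F(y)+k\|x-y\|\,\overline{B_1(0)}$ for all $x,y\in K$. Let $\psi:X\times X\to(0,\infty)$ be continuous, let $X_{obst}\subset X$ be closed, and put $X_{free}=X\setminus X_{obst}$. For $x,y\in X$ let $\Pi(x,y)$ be the set of absolutely continuous $\pi:[0,T]\to X$, with $T=T_\pi\ge 0$, such that $\dot\pi(t)\in F(\pi(t))$ for a.e. $t\in[0,T]$, $\pi(0)=x$, $\pi(T)=y$, and $\pi(t)\in\overline{X_{free}}$ for all $t\in[0,T]$.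 Define $c_\pi=\int_0^{T_\pi}\psi(\pi(t),\dot\pi(t))\,dt$ and, with values in $[0,\infty]$ and $\inf\emptyset=\infty$, $$d_c(x,y)=\inf_{\pi\in\Pi(x,y)}c_\pi,\qquad \mathrm{clr}(x)=\inf_{y\in X_{obst}}d_c(x,y).$$ For $\rho>0$ define the forward and reverse reachable sets $\mathcal F_\rho(x)=\{y: d_c(x,y)<\rho\}$ and $\mathcal R_\rho(x)=\{y: d_c(y,x)<\rho\}$, and the wave $W_\rho=\{x\in X_{free}:\mathrm{clr}(x)<\rho\}$. For $x\in X_{free}$ let $$\rho_{min}(x)=\inf\{\rho>0:x\in\partial W_\rho\},\qquad \rho_{max}(x)=\sup\{\rho>0:x\in\partial W_\rho\},$$ with both set to $\infty$ if $\mathrm{clr}(x)=\infty$. The wave envelope is $E=\{x\in X_{free}:\rho_{min}(x)<\rho_{max}(x)\}$. A point $y_0\in\partial X_{obst}$ is called an *envelope generator* if there is a sequence $x_n\in E$ with $x_n\to y_0$ and $\rho_{min}(x_n)\to 0$. The set of *shelf points* is $\mathcal S=\{y\in\partial X_{obst}:\mathcal R_\rho(y)\cap X_{free}=\emptyset\text{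 for some }\rho>0\}$. **Theorem.** Let $y_0\in\partial X_{obst}$ and assume: * (H1) there are $\xi\in X$ and $r^\star>0$ such that $h_F(y_0,\xi):=\inf_{v\in F(y_0)}\langle v,\xi\rangle>0$ and $B_{r^\star}\big(y_0+\tfrac{r^\star}{\|\xi\|}\xi\big)\cap\partial X_{obst}\subseteq\mathcal S$; * (H2) there is $r_0>0$ such that $B_r(y_0)\cap X_{free}$ is connected for all $0<r<r_0$; * $\mathcal F_\rho(y_0)\cap X_{free}\ne\emptyset$ and $\mathcal R_\rho(y_0)\cap X_{free}\ne\emptyset$ for all $\rho>0$. Then $y_0$ is an envelope generator. -/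

import Mathlib

open Set Filter Topology MeasureTheory
open scoped ENNReal Pointwise

/-- The data of a control problem on the state space `X`: the velocity multifunction `F`
(for a parameterized system `f` with control set `U` this is `F x = {f (x, u) | u ∈ U}`), the running
cost `ψ` and the obstacle set. -/
structure ControlSystem (X : Type*) where
  F : X → Set X
  ψ : X × X → ℝ
  obst : Set X

namespace ControlSystem

variable {X : Type*} [NormedAddCommGroup X] [InnerProductSpace ℝ X]

/-- Standing assumptions: (SH1) nonempty convex locally bounded velocity sets with closed graph,
(SH2) linear growth, (SH3) local Lipschitz regularity, a positive continuous running cost and a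
closed obstacle set. -/
structure StandingHypotheses (S : ControlSystem X) : Prop where
  nonempty_F : ∀ x, (S.F x).Nonempty
  convex_F : ∀ x, Convex ℝ (S.F x)
  isClosed_graph : IsClosed {p : X × X | p.2 ∈ S.F p.1}
  locallyBounded_F : ∀ K : Set X, IsCompact K → ∃ M > (0 : ℝ), ∀ x ∈ K, ∀ v ∈ S.F x, ‖v‖ ≤ M
  linearGrowth_F : ∃ γ > (0 : ℝ), ∃ c > (0 : ℝ), ∀ x, ∀ v ∈ S.F x, ‖v‖ ≤ γ * ‖x‖ + c
  locallyLipschitz_F : ∀ K : Set X, IsCompact K → ∃ k > (0 : ℝ), ∀ x ∈ K, ∀ y ∈ K,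
    S.F x ⊆ S.F y + (k * ‖x - y‖) • Metric.closedBall (0 : X) 1
  continuous_ψ : Continuous S.ψ
  ψ_pos : ∀ p, 0 < S.ψ p
  isClosed_obst : IsClosed S.obst

/-- The minimal Hamiltonian `h_F(x, ξ) = inf_{v ∈ F(x)} ⟨v, ξ⟩`. -/
noncomputable def minHamiltonian (S : ControlSystem X) (x ξ : X) : ℝ :=
  sInf ((fun v : X => inner ℝ v ξ) '' S.F x)

/-- The free space. -/
def free (S : ControlSystem X) : Set X := S.obstᶜ

/-- `π`, restricted to `[0, T]`, is an unconstrained trajectory moving `x` to `y` in time `T`: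
an absolutely continuous solution of `π' ∈ F(π)` a.e. on `[0, T]` with `π 0 = x`, `π T = y`. -/
structure IsUnconstrainedTrajectory (S : ControlSystem X) (x y : X) (T : ℝ) (π : ℝ → X) :
    Prop where
  time_nonneg : 0 ≤ T
  absolutelyContinuous : AbsolutelyContinuousOnInterval π 0 T
  velocity_mem : ∀ᵐ t ∂(volume.restrict (Icc 0 T)),
    DifferentiableAt ℝ π t ∧ deriv π t ∈ S.F (π t)
  source : π 0 = x
  target : π T = y

/-- An admissible trajectory moving `x` to `y`: an unconstrained one that stays in the closure of
the free space. -/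
def IsTrajectory (S : ControlSystem X) (x y : X) (T : ℝ) (π : ℝ → X) : Prop :=
  S.IsUnconstrainedTrajectory x y T π ∧ ∀ t ∈ Icc 0 T, π t ∈ closure S.free

/-- The cost `c_π = ∫₀ᵀ ψ(π(t), π'(t)) dt`, as an integral of a positive function with values in
`[0, ∞]`. -/
noncomputable def trajectoryCost (S : ControlSystem X) (T : ℝ) (π : ℝ → X) : ℝ≥0∞ :=
  ∫⁻ t in Icc 0 T, ENNReal.ofReal (S.ψ (π t, deriv π t))

/-- The cost-distance `d_c(x, y)`; it is `∞` if no admissible trajectory moves `x` to `y`. -/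
noncomputable def costDist (S : ControlSystem X) (x y : X) : ℝ≥0∞ :=
  ⨅ (T : ℝ) (π : ℝ → X) (_ : S.IsTrajectory x y T π), S.trajectoryCost T π

/-- The forward reachable set of radius `ρ`. -/
def forwardReach (S : ControlSystem X) (ρ : ℝ) (x : X) : Set X :=
  {y | S.costDist x y < ENNReal.ofReal ρ}

/-- The reverse reachable set of radius `ρ`. -/
def reverseReach (S : ControlSystem X) (ρ : ℝ) (x : X) : Set X :=
  {y | x ∈ S.forwardReach ρ y}

/-- The clearance from the obstacle. -/
noncomputable def clr (S : ControlSystem X) (x : X) : ℝ≥0∞ :=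
  ⨅ y ∈ S.obst, S.costDist x y

/-- The propagating wave `W_ρ`. -/
def wave (S : ControlSystem X) (ρ : ℝ) : Set X :=
  {x | x ∈ S.free ∧ S.clr x < ENNReal.ofReal ρ}

open Classical in
/-- First arrival of wave fronts, `ρ_min`. -/
noncomputable def rhoMin (S : ControlSystem X) (x : X) : ℝ≥0∞ :=
  if S.clr x = ⊤ then ⊤
  else ⨅ (ρ : ℝ) (_ : 0 < ρ) (_ : x ∈ frontier (S.wave ρ)), ENNReal.ofReal ρ

open Classical in
/-- Last arrival of wave fronts, `ρ_max`. -/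
noncomputable def rhoMax (S : ControlSystem X) (x : X) : ℝ≥0∞ :=
  if S.clr x = ⊤ then ⊤
  else ⨆ (ρ : ℝ) (_ : 0 < ρ) (_ : x ∈ frontier (S.wave ρ)), ENNReal.ofReal ρ

/-- The wave envelope `E`. -/
def envelope (S : ControlSystem X) : Set X :=
  {x | x ∈ S.free ∧ S.rhoMin x < S.rhoMax x}

/-- An obstacle boundary point that is a limit of envelope points with `ρ_min` tending to `0`. -/
def IsEnvelopeGenerator (S : ControlSystem X) (y₀ : X) : Prop :=
  y₀ ∈ frontier S.obst ∧
    ∃ x : ℕ → X, (∀ n, x n ∈ S.envelope) ∧ Tendsto x atTop (𝓝 y₀) ∧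
      Tendsto (fun n => S.rhoMin (x n)) atTop (𝓝 0)

/-- The shelf points: obstacle boundary points with a reverse reachable set that misses the free
space. -/
def shelf (S : ControlSystem X) : Set X :=
  {y | y ∈ frontier S.obst ∧ ∃ ρ : ℝ, 0 < ρ ∧ S.reverseReach ρ y ∩ S.free = ∅}

/-- Assumption (H1) at `y₀`. -/
def H1 (S : ControlSystem X) (y₀ : X) : Prop :=
  ∃ (ξ : X) (r : ℝ), 0 < r ∧ 0 < S.minHamiltonian y₀ ξ ∧
    Metric.ball (y₀ + (r / ‖ξ‖) • ξ) r ∩ frontier S.obst ⊆ S.shelf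

/-- Assumption (H2) at `y₀`. -/
def H2 (S : ControlSystem X) (y₀ : X) : Prop :=
  ∃ r₀ : ℝ, 0 < r₀ ∧ ∀ r : ℝ, 0 < r → r < r₀ → IsConnected (Metric.ball y₀ r ∩ S.free)

end ControlSystem

/-! ### Increments of absolutely continuous curves -/

namespace AbsolutelyContinuousOnInterval

/-! Near `y₀` every velocity has component at least `a > 0` along the unit vector `e = ξ/‖ξ‖` and
norm at most `M`. A curve starting at `y₀` has therefore, after a short time `t`, moved by at least
`a t` along `e` and by at most `M t` in all, so it lies inside the ball that touches `y₀` in the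
direction `e`. By (H1) the obstacle boundary inside that ball consists of shelf points, and a
trajectory from free space cannot first meet the obstacle at a shelf point (`exists_first_hit`).

This creates a gap in the values of the clearance. A trajectory that starts within `ε` of `y₀` and
costs less than the fixed amount `m τ` can hit the obstacle only before time `2ε/a`, since later it
is inside the touching ball; its starting point then has clearance at most `2Cε/a`
(`HasLocalBounds.clr_le`). So on a small ball around `y₀` of radius `η` the waves of radii `κη` and
`m τ` coincide. Free points that reach `y₀` cheaply belong to this common wave, and free points
reached cheaply from `y₀` do not (`HasLocalBounds.le_clr`). By (H2) the front of the wave crosses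
the free part of the ball, and a crossing point lies on both fronts: `ρ_min ≤ κη < m τ ≤ ρ_max`.
Compactness of trajectories gives this point finite clearance, which the definition of the envelope
requires. Letting `η → 0` finishes the proof. -/

theorem continuousLinearMap_comp {E G : Type*} [NormedAddCommGroup E] [NormedSpace ℝ E]
    [NormedAddCommGroup G] [NormedSpace ℝ G] {f : ℝ → E} {a b : ℝ}
    (hf : AbsolutelyContinuousOnInterval f a b) (L : E →L[ℝ] G) :
    AbsolutelyContinuousOnInterval (fun t => L (f t)) a b := by
  apply squeeze_zero (fun t ↦ ?_) (fun t ↦ ?_)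
    (by simpa using Filter.Tendsto.const_mul ‖L‖ hf)
  · exact Finset.sum_nonneg (fun i hi ↦ by positivity)
  · rw [Finset.mul_sum]
    gcongr
    rw [dist_eq_norm, dist_eq_norm, ← map_sub]
    exact L.le_opNorm _

/-- An almost everywhere lower bound of the derivative in the direction of a continuous linear
functional integrates to a lower bound of the increment. -/
theorem mul_sub_le_of_ae_le_deriv {E : Type*} [NormedAddCommGroup E] [NormedSpace ℝ E]
    {f : ℝ → E} {a b c : ℝ} (hab : a ≤ b) (hf : AbsolutelyContinuousOnInterval f a b)
    (L : E →L[ℝ] ℝ)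
    (h : ∀ᵐ t : ℝ, t ∈ Ioo a b → DifferentiableAt ℝ f t ∧ c ≤ L (deriv f t)) :
    c * (b - a) ≤ L (f b) - L (f a) := by
  have hg := hf.continuousLinearMap_comp L
  rw [← hg.integral_deriv_eq_sub]
  have h1 : ∫ _ in a..b, c = c * (b - a) := by simp [mul_comm]
  rw [← h1]
  refine intervalIntegral.integral_mono_ae_restrict hab (by simp) hg.intervalIntegrable_deriv ?_
  rw [EventuallyLE, ← Measure.restrict_congr_set Ioo_ae_eq_Icc, ae_restrict_iff' measurableSet_Ioo]
  filter_upwards [h] with t ht hmem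
  obtain ⟨hd, hc⟩ := ht hmem
  have : HasDerivAt (fun t => L (f t)) (L (deriv f t)) t :=
    L.hasFDerivAt.comp_hasDerivAt t hd.hasDerivAt
  rwa [this.deriv]

/-- An almost everywhere bound of the speed bounds the length of the increment. -/
theorem norm_sub_le_of_ae_norm_deriv_le {E : Type*} [NormedAddCommGroup E]
    [InnerProductSpace ℝ E] {f : ℝ → E} {a b M : ℝ} (hab : a ≤ b)
    (hf : AbsolutelyContinuousOnInterval f a b)
    (h : ∀ᵐ t : ℝ, t ∈ Ioo a b → DifferentiableAt ℝ f t ∧ ‖deriv f t‖ ≤ M) :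
    ‖f b - f a‖ ≤ M * (b - a) := by
  set w := f b - f a with hw
  rcases eq_or_lt_of_le (norm_nonneg w) with h0 | h0
  · rcases eq_or_lt_of_le hab with rfl | hlt
    · simp [hw]
    · rw [← h0]
      -- `0 ≤ M` is not assumed; it follows from the speed bound at a single point of the nonempty
      -- interval.
      have hpos : volume (Ioo a b) ≠ 0 := by simp [hlt]
      obtain ⟨t, ht, ht'⟩ : ∃ t, t ∈ Ioo a b ∧ ‖deriv f t‖ ≤ M := by
        by_contra! hcon
        apply hpos
        refine measure_mono_null (fun t ht => ?_) h
        intro h'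
        exact absurd (h' ht).2 (not_le.2 (hcon t ht))
      exact mul_nonneg ((norm_nonneg _).trans ht') (by linarith)
  -- Test the increment `w` against the functional `⟨-w, ·⟩`, then divide by `‖w‖`.
  · have key := hf.mul_sub_le_of_ae_le_deriv (c := -(‖w‖ * M)) hab (innerSL ℝ (-w)) (by
      filter_upwards [h] with t ht hmem
      refine ⟨(ht hmem).1, ?_⟩
      rw [innerSL_apply_apply, inner_neg_left, neg_le_neg_iff]
      exact (real_inner_le_norm _ _).trans
        (mul_le_mul_of_nonneg_left (ht hmem).2 (norm_nonneg _)))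
    rw [← map_sub, ← hw, innerSL_apply_apply, inner_neg_left, real_inner_self_eq_norm_sq] at key
    have : ‖w‖ * ‖w‖ ≤ ‖w‖ * (M * (b - a)) := by nlinarith
    exact le_of_mul_le_mul_left this h0

end AbsolutelyContinuousOnInterval

/-! ### Trajectories: displacement, pieces and cost -/

namespace ControlSystem

variable {X : Type*} [NormedAddCommGroup X] [InnerProductSpace ℝ X] {S : ControlSystem X}
  {x y : X} {T : ℝ} {π : ℝ → X}

namespace IsUnconstrainedTrajectory

theorem ae_velocity_mem (h : S.IsUnconstrainedTrajectory x y T π) :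
    ∀ᵐ t : ℝ, t ∈ Icc 0 T → DifferentiableAt ℝ π t ∧ deriv π t ∈ S.F (π t) :=
  (ae_restrict_iff' measurableSet_Icc).1 h.velocity_mem

theorem continuousOn (h : S.IsUnconstrainedTrajectory x y T π) : ContinuousOn π (Icc 0 T) := by
  have := h.absolutelyContinuous.continuousOn
  rwa [uIcc_of_le h.time_nonneg] at this

theorem absolutelyContinuous_mono (h : S.IsUnconstrainedTrajectory x y T π) {s t : ℝ}
    (hs : 0 ≤ s) (hst : s ≤ t) (ht : t ≤ T) : AbsolutelyContinuousOnInterval π s t := by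
  apply h.absolutelyContinuous.mono
  rw [uIcc_of_le hst, uIcc_of_le h.time_nonneg]
  exact Icc_subset_Icc hs ht

/-- A lower bound of a linear functional on the velocities met between `s` and `t` bounds its
increment. -/
theorem mul_sub_le (h : S.IsUnconstrainedTrajectory x y T π) {s t c : ℝ} (hs : 0 ≤ s)
    (hst : s ≤ t) (ht : t ≤ T) (L : X →L[ℝ] ℝ)
    (hc : ∀ r ∈ Ioo s t, ∀ v ∈ S.F (π r), c ≤ L v) : c * (t - s) ≤ L (π t) - L (π s) := by
  refine (h.absolutelyContinuous_mono hs hst ht).mul_sub_le_of_ae_le_deriv hst L ?_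
  filter_upwards [h.ae_velocity_mem] with r hr hmem
  have := hr ⟨hs.trans hmem.1.le, hmem.2.le.trans ht⟩
  exact ⟨this.1, hc r hmem _ this.2⟩

theorem norm_sub_le (h : S.IsUnconstrainedTrajectory x y T π) {s t M : ℝ} (hs : 0 ≤ s)
    (hst : s ≤ t) (ht : t ≤ T) (hM : ∀ r ∈ Ioo s t, ∀ v ∈ S.F (π r), ‖v‖ ≤ M) :
    ‖π t - π s‖ ≤ M * (t - s) := by
  refine (h.absolutelyContinuous_mono hs hst ht).norm_sub_le_of_ae_norm_deriv_le hst ?_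
  filter_upwards [h.ae_velocity_mem] with r hr hmem
  have := hr ⟨hs.trans hmem.1.le, hmem.2.le.trans ht⟩
  exact ⟨this.1, hM r hmem _ this.2⟩

/-- A trajectory that is close to `p` at time `t₀` stays near `p` for a while, in both directions
of time. -/
theorem mem_ball_of_abs_sub_le (h : S.IsUnconstrainedTrajectory x y T π) {p : X} {R M t₀ t : ℝ}
    (hM0 : 0 < M) (hM : ∀ q ∈ Metric.closedBall p R, ∀ v ∈ S.F q, ‖v‖ ≤ M)
    (ht₀ : t₀ ∈ Icc 0 T) (hp : ‖π t₀ - p‖ < R / 2) (ht : t ∈ Icc 0 T)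
    (htt : |t - t₀| ≤ R / (2 * M)) : π t ∈ Metric.ball p R := by
  rw [mem_ball_iff_norm]
  by_contra! hcon
  have hsub : uIcc t₀ t ⊆ Icc 0 T := ordConnected_Icc.uIcc_subset ht₀ ht
  have hcont : ContinuousOn (fun s => ‖π s - p‖) (uIcc t₀ t) :=
    ((h.continuousOn.mono hsub).sub continuousOn_const).norm
  have hK : IsCompact (uIcc t₀ t ∩ (fun s => ‖π s - p‖) ⁻¹' Ici R) :=
    isCompact_uIcc.of_isClosed_subset
      (hcont.preimage_isClosed_of_isClosed isCompact_uIcc.isClosed isClosed_Ici) inter_subset_left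
  -- Among the times at distance at least `R` from `p`, take the one closest to `t₀`: in between the
  -- curve stays in the ball, where `M` bounds the speed.
  obtain ⟨s, ⟨hs, hsR⟩, hmin⟩ := hK.exists_isMinOn ⟨t, right_mem_uIcc, hcon⟩
    (f := fun s => |s - t₀|) (by fun_prop)
  have hsR' : R ≤ ‖π s - p‖ := hsR
  have hst : |s - t₀| ≤ |t - t₀| := by
    rcases mem_uIcc.1 hs with h' | h'
    · rw [abs_of_nonneg (by linarith), abs_of_nonneg (by linarith)]; linarith
    · rw [abs_of_nonpos (by linarith), abs_of_nonpos (by linarith)]; linarith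
  have hball : ∀ r ∈ uIcc t₀ s, |r - t₀| < |s - t₀| → π r ∈ Metric.closedBall p R := by
    intro r hr hlt
    rw [mem_closedBall_iff_norm]
    by_contra! hgt
    exact absurd (hmin ⟨uIcc_subset_uIcc left_mem_uIcc hs hr, hgt.le⟩) (not_le.2 hlt)
  have hkey : ‖π s - π t₀‖ ≤ M * |s - t₀| := by
    rcases le_total t₀ s with hle | hle
    · rw [abs_of_nonneg (by linarith)]
      refine h.norm_sub_le ht₀.1 hle (hsub hs).2 fun r hr v hv => hM _ (hball r ?_ ?_) v hv
      · rw [uIcc_of_le hle]; exact Ioo_subset_Icc_self hr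
      · rw [abs_of_nonneg (by linarith [hr.1]), abs_of_nonneg (by linarith)]; linarith [hr.2]
    · rw [norm_sub_rev, abs_of_nonpos (by linarith), neg_sub]
      refine h.norm_sub_le (hsub hs).1 hle ht₀.2 fun r hr v hv => hM _ (hball r ?_ ?_) v hv
      · rw [uIcc_of_ge hle]; exact Ioo_subset_Icc_self hr
      · rw [abs_of_nonpos (by linarith [hr.2]), abs_of_nonpos (by linarith)]; linarith [hr.1]
  have h1 : M * |s - t₀| ≤ R / 2 := by
    calc M * |s - t₀| ≤ M * (R / (2 * M)) := by gcongr; exact hst.trans htt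
      _ = R / 2 := by field_simp
  have h2 : ‖π s - p‖ ≤ ‖π s - π t₀‖ + ‖π t₀ - p‖ := by
    simpa using norm_add_le (π s - π t₀) (π t₀ - p)
  linarith

end IsUnconstrainedTrajectory
theorem IsUnconstrainedTrajectory.exists_norm_sub_le (h : S.IsUnconstrainedTrajectory x y T π)
    (hS : S.StandingHypotheses) :
    ∃ M > (0 : ℝ), ∀ s t, 0 ≤ s → s ≤ t → t ≤ T → ‖π t - π s‖ ≤ M * (t - s) := by
  obtain ⟨M, hM0, hM⟩ := hS.locallyBounded_F _ (isCompact_Icc.image_of_continuousOn h.continuousOn)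
  refine ⟨M, hM0, fun s t hs hst ht => h.norm_sub_le hs hst ht fun r hr v hv => ?_⟩
  exact hM _ ⟨r, ⟨hs.trans hr.1.le, hr.2.le.trans ht⟩, rfl⟩ v hv

/-- The piece of a trajectory between two times is a trajectory. -/
theorem IsTrajectory.shift (h : S.IsTrajectory x y T π) (hS : S.StandingHypotheses) {s t : ℝ}
    (hs : 0 ≤ s) (hst : s ≤ t) (ht : t ≤ T) :
    S.IsTrajectory (π s) (π t) (t - s) (fun r => π (s + r)) := by
  obtain ⟨M, hM0, hM⟩ := h.1.exists_norm_sub_le hS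
  refine ⟨⟨by linarith, ?_, ?_, by simp, by simp⟩, fun r hr => h.2 _ ?_⟩
  -- A trajectory has compact image, hence bounded speed, so it is Lipschitz and translation of time
  -- is harmless.
  · have : LipschitzOnWith ⟨M, hM0.le⟩ (fun r => π (s + r)) (uIcc 0 (t - s)) := by
      rw [uIcc_of_le (by linarith)]
      refine LipschitzOnWith.of_dist_le_mul fun a ha b hb => ?_
      change dist (π (s + a)) (π (s + b)) ≤ M * dist a b
      wlog hab : b ≤ a generalizing a b
      · rw [dist_comm, dist_comm a]
        exact this b hb a ha (le_of_not_ge hab)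
      rw [dist_eq_norm, Real.dist_eq, abs_of_nonneg (by linarith)]
      convert hM (s + b) (s + a) (by linarith [hb.1]) (by linarith) (by linarith [ha.2]) using 2
      ring
    exact this.absolutelyContinuousOnInterval
  · rw [ae_restrict_iff' measurableSet_Icc]
    have h1 : ∀ᵐ r : ℝ, s + r ∈ Icc 0 T →
        DifferentiableAt ℝ π (s + r) ∧ deriv π (s + r) ∈ S.F (π (s + r)) :=
      (measurePreserving_add_left volume s).quasiMeasurePreserving.ae h.1.ae_velocity_mem
    filter_upwards [h1] with r hr hmem
    have := hr ⟨by linarith [hmem.1], by linarith [hmem.2]⟩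
    rw [differentiableAt_comp_add_left, deriv_comp_const_add]
    exact this
  · exact ⟨by linarith [hr.1], by linarith [hr.2]⟩

theorem trajectoryCost_le (h : S.IsUnconstrainedTrajectory x y T π) {C : ℝ}
    (hC : ∀ t ∈ Icc 0 T, ∀ v ∈ S.F (π t), S.ψ (π t, v) ≤ C) :
    S.trajectoryCost T π ≤ ENNReal.ofReal C * ENNReal.ofReal T := by
  calc S.trajectoryCost T π ≤ ∫⁻ _ in Icc 0 T, ENNReal.ofReal C := by
        refine setLIntegral_mono_ae' measurableSet_Icc ?_
        filter_upwards [h.ae_velocity_mem] with t ht hmem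
        exact ENNReal.ofReal_le_ofReal (hC t hmem _ (ht hmem).2)
    _ = _ := by simp

theorem le_trajectoryCost (h : S.IsUnconstrainedTrajectory x y T π) {s t m : ℝ}
    (hs : 0 ≤ s) (ht : t ≤ T) (hm : ∀ r ∈ Icc s t, ∀ v ∈ S.F (π r), m ≤ S.ψ (π r, v)) :
    ENNReal.ofReal m * ENNReal.ofReal (t - s) ≤ S.trajectoryCost T π := by
  calc _ = ∫⁻ _ in Icc s t, ENNReal.ofReal m := by simp
    _ ≤ ∫⁻ t in Icc s t, ENNReal.ofReal (S.ψ (π t, deriv π t)) := by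
        refine setLIntegral_mono_ae' measurableSet_Icc ?_
        filter_upwards [h.ae_velocity_mem] with r hr hmem
        exact ENNReal.ofReal_le_ofReal (hm r hmem _ (hr (Icc_subset_Icc hs ht hmem)).2)
    _ ≤ _ := lintegral_mono_set (Icc_subset_Icc hs ht)

/-- On a compact set of states the running cost of admissible velocities lies between two
positive constants. -/
theorem StandingHypotheses.exists_cost_bounds [FiniteDimensional ℝ X]
    (hS : S.StandingHypotheses) {K : Set X} (hK : IsCompact K) :
    ∃ m > (0 : ℝ), ∃ C > (0 : ℝ), ∀ p ∈ K, ∀ v ∈ S.F p, m ≤ S.ψ (p, v) ∧ S.ψ (p, v) ≤ C := by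
  obtain ⟨M, hM0, hM⟩ := hS.locallyBounded_F K hK
  rcases K.eq_empty_or_nonempty with rfl | hne
  · exact ⟨1, one_pos, 1, one_pos, by simp⟩
  have hK' : IsCompact (K ×ˢ Metric.closedBall (0 : X) M) :=
    hK.prod (isCompact_closedBall _ _)
  have hne' : (K ×ˢ Metric.closedBall (0 : X) M).Nonempty :=
    hne.prod ⟨0, Metric.mem_closedBall_self hM0.le⟩
  obtain ⟨p, -, hp⟩ := hK'.exists_isMinOn hne' hS.continuous_ψ.continuousOn
  obtain ⟨q, -, hq⟩ := hK'.exists_isMaxOn hne' hS.continuous_ψ.continuousOn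
  refine ⟨S.ψ p, hS.ψ_pos p, S.ψ q, hS.ψ_pos q, fun z hz v hv => ?_⟩
  have hmem : (z, v) ∈ K ×ˢ Metric.closedBall (0 : X) M :=
    ⟨hz, mem_closedBall_zero_iff.2 (hM z hz v hv)⟩
  exact ⟨hp hmem, hq hmem⟩

theorem costDist_le (h : S.IsTrajectory x y T π) : S.costDist x y ≤ S.trajectoryCost T π :=
  iInf_le_of_le T (iInf_le_of_le π (iInf_le _ h))

theorem exists_trajectory_of_costDist_lt {c : ℝ≥0∞} (h : S.costDist x y < c) :
    ∃ T π, S.IsTrajectory x y T π ∧ S.trajectoryCost T π < c := by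
  simpa [costDist, iInf_lt_iff] using h

theorem exists_trajectory_of_clr_lt {c : ℝ≥0∞} (h : S.clr x < c) :
    ∃ y ∈ S.obst, ∃ T π, S.IsTrajectory x y T π ∧ S.trajectoryCost T π < c := by
  obtain ⟨y, hy, hlt⟩ : ∃ y ∈ S.obst, S.costDist x y < c := by
    simpa [clr, iInf_lt_iff] using h
  exact ⟨y, hy, exists_trajectory_of_costDist_lt hlt⟩

theorem clr_le (h : S.IsTrajectory x y T π) (hy : y ∈ S.obst) :
    S.clr x ≤ S.trajectoryCost T π :=
  (iInf₂_le y hy).trans (costDist_le h)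

theorem IsTrajectory.trajectoryCost_lt_top [FiniteDimensional ℝ X] (h : S.IsTrajectory x y T π)
    (hS : S.StandingHypotheses) : S.trajectoryCost T π < ⊤ := by
  obtain ⟨m, -, C, -, hC⟩ :=
    hS.exists_cost_bounds (isCompact_Icc.image_of_continuousOn h.1.continuousOn)
  exact (trajectoryCost_le h.1 fun t ht v hv => (hC _ ⟨t, ht, rfl⟩ v hv).2).trans_lt
    (ENNReal.mul_lt_top ENNReal.ofReal_lt_top ENNReal.ofReal_lt_top)

/-- A trajectory from the free space to the obstacle first meets the obstacle at a boundary point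
that is not a shelf point. -/
theorem IsTrajectory.exists_first_hit [FiniteDimensional ℝ X] (h : S.IsTrajectory x y T π)
    (hS : S.StandingHypotheses) (hx : x ∈ S.free) (hy : y ∈ S.obst) :
    ∃ τ ∈ Icc 0 T, π τ ∈ frontier S.obst ∧ π τ ∉ S.shelf := by
  have hK : IsCompact (Icc 0 T ∩ π ⁻¹' S.obst) :=
    isCompact_Icc.of_isClosed_subset
      (h.1.continuousOn.preimage_isClosed_of_isClosed isClosed_Icc hS.isClosed_obst)
      inter_subset_left
  obtain ⟨τ, ⟨hτ, hτo⟩, hmin⟩ := hK.exists_isMinOn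
    ⟨T, ⟨h.1.time_nonneg, le_rfl⟩, by rw [mem_preimage, h.1.target]; exact hy⟩ continuousOn_id
  have hfree : ∀ s, 0 ≤ s → s < τ → π s ∈ S.free := fun s hs0 hs hso =>
    absurd (hmin ⟨⟨hs0, hs.le.trans hτ.2⟩, hso⟩) (not_le.2 hs)
  have hτ0 : 0 < τ := by
    rcases eq_or_lt_of_le hτ.1 with h0 | h0
    · rw [mem_preimage, ← h0, h.1.source] at hτo
      exact absurd hτo hx
    · exact h0
  refine ⟨τ, hτ, ?_, ?_⟩
  -- Admissibility keeps the curve in the closure of the free space, so it avoids the interior of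
  -- the obstacle.
  · rw [hS.isClosed_obst.frontier_eq, Set.mem_sdiff]
    refine ⟨hτo, fun hint => ?_⟩
    have := h.2 τ hτ
    rw [free, closure_compl] at this
    exact this hint
  · rintro ⟨-, ρ, hρ, hempty⟩
    obtain ⟨m, -, C, hC0, hC⟩ :=
      hS.exists_cost_bounds (isCompact_Icc.image_of_continuousOn h.1.continuousOn)
    -- Backing up by the time `η` gives a free point that reaches `π τ` at cost at most `C η ≤ ρ /
    -- 2`, so `π τ` is not a shelf point.
    set η := min τ (ρ / (2 * C)) with hη
    have hη0 : 0 < η := by positivity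
    have hητ : η ≤ τ := min_le_left _ _
    have hsh := h.shift hS (s := τ - η) (t := τ) (by linarith) (by linarith) hτ.2
    have hcost : S.costDist (π (τ - η)) (π τ) < ENNReal.ofReal ρ := by
      refine (costDist_le hsh).trans_lt ((trajectoryCost_le hsh.1 (C := C) ?_).trans_lt ?_)
      · intro t ht v hv
        exact (hC _ ⟨τ - η + t, ⟨by linarith [ht.1], by linarith [ht.2, hτ.2]⟩, rfl⟩ v hv).2
      · rw [← ENNReal.ofReal_mul hC0.le, ENNReal.ofReal_lt_ofReal_iff hρ]
        calc C * (τ - (τ - η)) = C * η := by ring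
          _ ≤ C * (ρ / (2 * C)) := by gcongr; exact min_le_right _ _
          _ = ρ / 2 := by field_simp
          _ < ρ := by linarith
    have hmem : π (τ - η) ∈ S.reverseReach ρ (π τ) ∩ S.free :=
      ⟨hcost, hfree _ (by linarith) (by linarith)⟩
    rw [hempty] at hmem
    exact hmem

/-! ### Compactness of trajectories -/

theorem StandingHypotheses.isClosed_F (hS : S.StandingHypotheses) (p : X) : IsClosed (S.F p) :=
  hS.isClosed_graph.preimage (f := fun v => (p, v)) (by fun_prop)

/-- The lower bound of a linear functional on the velocities varies in a Lipschitz way. -/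
theorem sub_le_of_subset_add_smul_closedBall {A B : Set X} {c δ : ℝ} (hδ : 0 ≤ δ)
    (hAB : A ⊆ B + δ • Metric.closedBall (0 : X) 1) (L : X →L[ℝ] ℝ) (hB : ∀ b ∈ B, c ≤ L b) :
    ∀ v ∈ A, c - ‖L‖ * δ ≤ L v := by
  intro v hv
  obtain ⟨b, hb, w, ⟨z, hz, rfl⟩, rfl⟩ := hAB hv
  rw [mem_closedBall_zero_iff] at hz
  have h1 : ‖L (δ • z)‖ ≤ ‖L‖ * δ := by
    refine (L.le_opNorm _).trans ?_
    rw [norm_smul, Real.norm_of_nonneg hδ]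
    have : δ * ‖z‖ ≤ δ := mul_le_of_le_one_right hδ hz
    gcongr
  have h2 := (abs_le.1 (Real.norm_eq_abs _ ▸ h1)).1
  have := hB b hb
  simp only [map_add]
  linarith

/-- A derivative at a point where the increments are bounded below up to second order. -/
theorem le_deriv_of_forall_increment {f : ℝ → X} {t c D η₀ : ℝ} (hη₀ : 0 < η₀)
    (hf : DifferentiableAt ℝ f t) (L : X →L[ℝ] ℝ)
    (h : ∀ η, 0 < η → η < η₀ → (c - D * η) * η ≤ L (f (t + η)) - L (f t)) :
    c ≤ L (deriv f t) := by
  have hg : HasDerivAt (fun t => L (f t)) (L (deriv f t)) t :=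
    L.hasFDerivAt.comp_hasDerivAt t hf.hasDerivAt
  have h1 : Tendsto (fun η : ℝ => c - D * η) (𝓝[>] 0) (𝓝 c) := by
    have : Tendsto (fun η : ℝ => c - D * η) (𝓝 0) (𝓝 (c - D * 0)) :=
      Continuous.tendsto (by fun_prop) 0
    rw [mul_zero, sub_zero] at this
    exact this.mono_left nhdsWithin_le_nhds
  refine le_of_tendsto_of_tendsto h1 hg.tendsto_slope_zero_right ?_
  filter_upwards [Ioo_mem_nhdsGT hη₀] with η hη
  rw [smul_eq_mul, inv_mul_eq_div, le_div_iff₀ hη.1]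
  exact h η hη.1 hη.2

/-- Trajectories in a compact set with bounded durations have a limit trajectory along every
ultrafilter. -/
theorem exists_tendsto_isTrajectory [FiniteDimensional ℝ X] (hS : S.StandingHypotheses)
    {ι : Type*} (U : Ultrafilter ι) {xs ys : ι → X} {Ts : ι → ℝ} {πs : ι → ℝ → X}
    (h : ∀ i, S.IsTrajectory (xs i) (ys i) (Ts i) (πs i)) {K : Set X} (hK : IsCompact K)
    (hin : ∀ i, ∀ t ∈ Icc 0 (Ts i), πs i t ∈ K) {T₁ : ℝ} (hT₁ : ∀ i, Ts i ≤ T₁)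
    (hx : Tendsto xs U (𝓝 x)) :
    ∃ y T π, Tendsto ys U (𝓝 y) ∧ S.IsTrajectory x y T π := by
  obtain ⟨M, hM0, hM⟩ := hS.locallyBounded_F K hK
  obtain ⟨k, hk0, hk⟩ := hS.locallyLipschitz_F K hK
  have hT0 : ∀ i, 0 ≤ Ts i := fun i => (h i).1.time_nonneg
  obtain ⟨T, hT, hTs⟩ : ∃ T ∈ Icc 0 T₁, Tendsto Ts U (𝓝 T) :=
    isCompact_Icc.ultrafilter_le_nhds (U.map Ts)
      (le_principal_iff.2 (mem_map.2 (univ_mem' fun i => ⟨hT0 i, hT₁ i⟩)))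
  -- Constant extension beyond the ends puts all curves on one time axis with a common Lipschitz
  -- constant, so pointwise ultralimits exist and are Lipschitz.
  set q : ι → ℝ → X := fun i t => πs i (max 0 (min t (Ts i))) with hq
  have hclamp : ∀ i t, max 0 (min t (Ts i)) ∈ Icc 0 (Ts i) := fun i t =>
    ⟨le_max_left _ _, max_le (hT0 i) (min_le_right _ _)⟩
  have hqK : ∀ i t, q i t ∈ K := fun i t => hin i _ (hclamp i t)
  have hqeq : ∀ i, ∀ t ∈ Icc 0 (Ts i), q i t = πs i t := fun i t ht => by
    simp only [hq]; rw [min_eq_left ht.2, max_eq_right ht.1]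
  have hqlip : ∀ i a b, a ≤ b → ‖q i b - q i a‖ ≤ M * (b - a) := by
    intro i a b hab
    have hle : max 0 (min a (Ts i)) ≤ max 0 (min b (Ts i)) := by gcongr
    refine ((h i).1.norm_sub_le (hclamp i a).1 hle (hclamp i b).2 fun r hr v hv =>
      hM _ (hin i r ⟨(hclamp i a).1.trans hr.1.le, hr.2.le.trans (hclamp i b).2⟩) v hv).trans ?_
    refine mul_le_mul_of_nonneg_left ?_ hM0.le
    have := abs_max_sub_max_le_abs (min b (Ts i)) (min a (Ts i)) 0
    have h3 := abs_min_sub_min_le_max b (Ts i) a (Ts i)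
    rw [sub_self, abs_zero, max_eq_left (abs_nonneg _), abs_of_nonneg (sub_nonneg.2 hab)] at h3
    rw [max_comm 0, max_comm 0]
    exact (le_abs_self _).trans (this.trans h3)
  have hlim : ∀ t, ∃ z ∈ K, Tendsto (fun i => q i t) U (𝓝 z) := fun t =>
    hK.ultrafilter_le_nhds (U.map fun i => q i t)
      (le_principal_iff.2 (mem_map.2 (univ_mem' fun i => hqK i t)))
  choose p hpK hp using hlim
  have hplip : ∀ a b, a ≤ b → ‖p b - p a‖ ≤ M * (b - a) := fun a b hab =>
    le_of_tendsto ((hp b).sub (hp a)).norm (Filter.Eventually.of_forall fun i => hqlip i a b hab)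
  have hpL : LipschitzWith ⟨M, hM0.le⟩ p := by
    refine LipschitzWith.of_dist_le_mul fun a b => ?_
    change dist (p a) (p b) ≤ M * dist a b
    wlog hab : b ≤ a generalizing a b
    · rw [dist_comm, dist_comm a]
      exact this b a (le_of_not_ge hab)
    rw [dist_eq_norm, Real.dist_eq, abs_of_nonneg (by linarith)]
    exact hplip b a hab
  have hys : Tendsto ys U (𝓝 (p T)) := by
    have h1 : Tendsto (fun i => ys i - q i T) U (𝓝 0) := by
      refine squeeze_zero_norm (a := fun i => M * |Ts i - T|) (fun i => ?_) ?_
      · have hy : ys i = q i (Ts i) := by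
          rw [hqeq i _ ⟨hT0 i, le_rfl⟩, (h i).1.target]
        rw [hy]
        rcases le_total T (Ts i) with hle | hle
        · rw [abs_of_nonneg (by linarith)]; exact hqlip i _ _ hle
        · rw [abs_of_nonpos (by linarith), norm_sub_rev, neg_sub]; exact hqlip i _ _ hle
      · have : Tendsto (fun i => M * |Ts i - T|) U (𝓝 (M * |T - T|)) :=
          ((hTs.sub_const T).abs).const_mul M
        simpa using this
    simpa using h1.add (hp T)
  have hvel : ∀ t ∈ Ioo 0 T, DifferentiableAt ℝ p t → deriv p t ∈ S.F (p t) := by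
    intro t ht hd
    by_contra hnot
    -- A derivative outside the closed convex set `F (p t)` is strictly separated from it; the
    -- increments of the approximating curves contradict this.
    obtain ⟨L, c, hLc, hcL⟩ :=
      geometric_hahn_banach_point_closed (hS.convex_F (p t)) (hS.isClosed_F (p t)) hnot
    -- During `[t, t + η]` the approximating curves stay within `(M + 1) * η` of `p t`: `M * η` from
    -- the speed and `η` from convergence at `t`. By the Lipschitz property of `F` the bound `c`
    -- drops by at most `‖L‖ * k * (M + 1) * η`.
    refine absurd (le_deriv_of_forall_increment (D := ‖L‖ * (k * (M + 1))) (sub_pos.2 ht.2) hd L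
      fun η hη hηT => ?_) (not_le.2 hLc)
    have hlimL : Tendsto (fun i => L (q i (t + η)) - L (q i t)) U
        (𝓝 (L (p (t + η)) - L (p t))) :=
      ((L.continuous.tendsto _).comp (hp (t + η))).sub ((L.continuous.tendsto _).comp (hp t))
    refine ge_of_tendsto hlimL ?_
    have hev : ∀ᶠ i in (U : Filter ι), ‖q i t - p t‖ < η := by
      have := (Metric.tendsto_nhds.1 (hp t)) η hη
      simpa only [dist_eq_norm] using this
    filter_upwards [hev, hTs.eventually_const_lt (show t + η < T by linarith)] with i hi hiT
    have ht0 := ht.1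
    rw [hqeq i t ⟨by linarith, by linarith⟩, hqeq i (t + η) ⟨by linarith, by linarith⟩]
    have := (h i).1.mul_sub_le (s := t) (t := t + η)
      (c := c - ‖L‖ * (k * (M + 1)) * η) (by linarith) (by linarith) hiT.le L ?_
    · simpa using this
    intro r hr v hv
    have hrI : r ∈ Icc 0 (Ts i) := ⟨by linarith [hr.1], by linarith [hr.2]⟩
    have hdist : ‖πs i r - p t‖ ≤ (M + 1) * η := by
      have h1 := hqlip i t r hr.1.le
      have h2 : ‖q i r - p t‖ ≤ ‖q i r - q i t‖ + ‖q i t - p t‖ := by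
        simpa using norm_add_le (q i r - q i t) (q i t - p t)
      rw [hqeq i r hrI] at h1 h2
      have h3 : M * (r - t) ≤ M * η := by gcongr; linarith [hr.2]
      linarith
    have h4 := sub_le_of_subset_add_smul_closedBall (by positivity)
      (hk _ (hin i r hrI) _ (hpK t)) L (fun b hb => (hcL b hb).le) v hv
    have h5 : ‖L‖ * (k * ‖πs i r - p t‖) ≤ ‖L‖ * (k * ((M + 1) * η)) := by gcongr
    linarith
  refine ⟨p T, T, p, hys, ⟨hT.1, hpL.lipschitzOnWith.absolutelyContinuousOnInterval, ?_, ?_, rfl⟩,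
    fun t _ => ?_⟩
  · rw [← Measure.restrict_congr_set Ioo_ae_eq_Icc, ae_restrict_iff' measurableSet_Ioo]
    filter_upwards [hpL.ae_differentiableAt_real] with t hd ht
    exact ⟨hd, hvel t ht hd⟩
  · refine tendsto_nhds_unique (hp 0) (hx.congr fun i => ?_)
    rw [hqeq i 0 ⟨le_rfl, hT0 i⟩, (h i).1.source]
  · exact isClosed_closure.mem_of_tendsto (hp t)
      (Filter.Eventually.of_forall fun i => (h i).2 _ (hclamp i t))

end ControlSystem

/-- If `s` missed the frontier, the interior of `W` and the complement of its closure would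
disconnect `s`. -/
theorem IsPreconnected.inter_frontier_nonempty {α : Type*} [TopologicalSpace α] {s W : Set α}
    (hs : IsPreconnected s) (h1 : (s ∩ W).Nonempty) (h2 : (s ∩ Wᶜ).Nonempty) :
    (s ∩ frontier W).Nonempty := by
  by_contra hne
  rw [not_nonempty_iff_eq_empty] at hne
  have hfr : ∀ z ∈ s, z ∈ closure W → z ∈ interior W := fun z hz hc => by
    by_contra hi
    exact (hne.subset ⟨hz, hc, hi⟩ : z ∈ (∅ : Set α))
  obtain ⟨a, has, haW⟩ := h1
  obtain ⟨b, hbs, hbW⟩ := h2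
  obtain ⟨z, -, hzi, hzc⟩ := hs (interior W) (closure W)ᶜ isOpen_interior
    isClosed_closure.isOpen_compl
    (fun z hz => or_iff_not_imp_right.2 fun hc => hfr z hz (not_not.1 hc))
    ⟨a, has, hfr a has (subset_closure haW)⟩
    ⟨b, hbs, fun hc => hbW (interior_subset (hfr b hbs hc))⟩
  exact hzc (interior_subset_closure hzi)

/-! ### Local analysis at the generator -/

namespace ControlSystem

variable {X : Type*} [NormedAddCommGroup X] [InnerProductSpace ℝ X] {S : ControlSystem X}
  {x y y₀ e : X} {T : ℝ} {π : ℝ → X} {R M a m C r : ℝ}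

/-- Bounds on the dynamics near `y₀`: speed at most `M`, drift at least `a` in the unit direction
`e`, running cost between `m` and `C`; and the obstacle boundary in the ball of radius `r` that
touches `y₀` in the direction `e` consists of shelf points. -/
structure HasLocalBounds (S : ControlSystem X) (y₀ e : X) (R M a m C r : ℝ) : Prop where
  R_pos : 0 < R
  M_pos : 0 < M
  a_pos : 0 < a
  m_pos : 0 < m
  C_pos : 0 < C
  r_pos : 0 < r
  norm_e : ‖e‖ = 1
  speed_le : ∀ p ∈ Metric.closedBall y₀ R, ∀ v ∈ S.F p, ‖v‖ ≤ M
  le_drift : ∀ p ∈ Metric.closedBall y₀ R, ∀ v ∈ S.F p, a ≤ innerSL ℝ e v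
  le_cost : ∀ p ∈ Metric.closedBall y₀ R, ∀ v ∈ S.F p, m ≤ S.ψ (p, v)
  cost_le : ∀ p ∈ Metric.closedBall y₀ R, ∀ v ∈ S.F p, S.ψ (p, v) ≤ C
  mem_shelf : ∀ p ∈ frontier S.obst, ‖p - y₀‖ ^ 2 < 2 * r * innerSL ℝ e (p - y₀) → p ∈ S.shelf

/-- The drift at `y₀` along the normalized `ξ` is at least some `c > 0`, and Lipschitz dependence of
`F` preserves half of it on a small ball. -/
theorem exists_hasLocalBounds [FiniteDimensional ℝ X] (hS : S.StandingHypotheses)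
    (hH1 : S.H1 y₀) : ∃ e R M a m C r, S.HasLocalBounds y₀ e R M a m C r := by
  obtain ⟨ξ, r, hr, hξ, hball⟩ := hH1
  obtain ⟨M, hM0, hM⟩ := hS.locallyBounded_F _ (isCompact_closedBall y₀ 1)
  obtain ⟨k, hk0, hk⟩ := hS.locallyLipschitz_F _ (isCompact_closedBall y₀ 1)
  obtain ⟨m, hm, C, hC0, hC⟩ := hS.exists_cost_bounds (isCompact_closedBall y₀ 1)
  have hy1 : y₀ ∈ Metric.closedBall y₀ 1 := Metric.mem_closedBall_self zero_le_one
  set b := S.minHamiltonian y₀ ξ with hb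
  have hdrift : ∀ v ∈ S.F y₀, b ≤ inner ℝ v ξ := by
    intro v hv
    -- Boundedness of `F y₀` makes the real infimum a genuine lower bound.
    refine csInf_le ⟨-(M * ‖ξ‖), ?_⟩ ⟨v, hv, rfl⟩
    rintro _ ⟨w, hw, rfl⟩
    have h1 := (abs_le.1 (abs_real_inner_le_norm w ξ)).1
    have h2 : ‖w‖ * ‖ξ‖ ≤ M * ‖ξ‖ := by gcongr; exact hM _ hy1 w hw
    simp only
    linarith
  have hξ0 : 0 < ‖ξ‖ := by
    rw [norm_pos_iff]
    rintro rfl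
    obtain ⟨v, hv⟩ := hS.nonempty_F y₀
    have := hdrift v hv
    rw [inner_zero_right] at this
    linarith
  set e := ‖ξ‖⁻¹ • ξ with he
  have hne : ‖e‖ = 1 := by rw [he, norm_smul, norm_inv, norm_norm, inv_mul_cancel₀ hξ0.ne']
  set c := ‖ξ‖⁻¹ * b with hc
  have hc0 : 0 < c := by positivity
  have hdrift' : ∀ v ∈ S.F y₀, c ≤ innerSL ℝ e v := by
    intro v hv
    rw [innerSL_apply_apply, he, real_inner_smul_left, real_inner_comm]
    exact mul_le_mul_of_nonneg_left (hdrift v hv) (by positivity)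
  have hsub : Metric.closedBall y₀ (min 1 (c / (2 * k))) ⊆ Metric.closedBall y₀ 1 :=
    Metric.closedBall_subset_closedBall (min_le_left _ _)
  -- Within `c / (2 * k)` of `y₀` the Lipschitz loss of drift is at most `c / 2`.
  refine ⟨e, min 1 (c / (2 * k)), M, c / 2, m, C, r, by positivity, hM0, by positivity, hm, hC0,
    hr, hne, fun p hp => hM p (hsub hp), fun p hp v hv => ?_, fun p hp v hv => (hC p (hsub hp) v hv).1,
    fun p hp v hv => (hC p (hsub hp) v hv).2, fun p hp hlt => hball ⟨?_, hp⟩⟩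
  · have h1 := sub_le_of_subset_add_smul_closedBall (by positivity) (hk p (hsub hp) y₀ hy1)
      (innerSL ℝ e) hdrift' v hv
    have h2 : k * ‖p - y₀‖ ≤ c / 2 := by
      calc k * ‖p - y₀‖ ≤ k * (c / (2 * k)) := by
            gcongr
            exact (mem_closedBall_iff_norm.1 hp).trans (min_le_right _ _)
        _ = c / 2 := by field_simp
    rw [innerSL_apply_norm, hne, one_mul] at h1
    linarith
  · have h1 : (r / ‖ξ‖) • ξ = r • e := by rw [he, smul_smul, div_eq_mul_inv]
    rw [h1, mem_ball_iff_norm, ← sub_sub]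
    refine lt_of_pow_lt_pow_left₀ 2 hr.le ?_
    rw [norm_sub_sq_real, real_inner_smul_right, norm_smul, hne, Real.norm_of_nonneg hr.le,
      real_inner_comm]
    rw [innerSL_apply_apply] at hlt
    nlinarith

namespace HasLocalBounds

theorem abs_inner_le (B : S.HasLocalBounds y₀ e R M a m C r) (p : X) :
    |innerSL ℝ e p| ≤ ‖p‖ := by
  have := abs_real_inner_le_norm e p
  rwa [B.norm_e, one_mul] at this

/-- A cheap trajectory with an end near `y₀` is short and stays near `y₀`. -/
theorem time_lt (B : S.HasLocalBounds y₀ e R M a m C r) (h : S.IsTrajectory x y T π)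
    (hxy : ‖x - y₀‖ < R / 2 ∨ ‖y - y₀‖ < R / 2) {τ : ℝ} (hτ : τ ≤ R / (2 * M))
    (hcost : S.trajectoryCost T π < ENNReal.ofReal (m * τ)) :
    T < τ ∧ ∀ t ∈ Icc 0 T, π t ∈ Metric.ball y₀ R := by
  have hT := h.1.time_nonneg
  have key : ∀ t₀ ∈ Icc 0 T, ‖π t₀ - y₀‖ < R / 2 → ∀ t ∈ Icc 0 T, |t - t₀| ≤ τ →
      π t ∈ Metric.ball y₀ R := fun t₀ ht₀ hp t ht htt =>
    h.1.mem_ball_of_abs_sub_le B.M_pos B.speed_le ht₀ hp ht (htt.trans hτ)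
  -- Spending a time `τ` in the ball already costs `m * τ`.
  have hexp : ∀ s t, 0 ≤ s → t ≤ T → t - s = τ →
      (∀ q ∈ Icc s t, π q ∈ Metric.ball y₀ R) → False := by
    intro s t hs ht hst hq
    refine absurd (le_trajectoryCost h.1 (m := m) hs ht fun q hmem v hv =>
      B.le_cost _ (Metric.ball_subset_closedBall (hq q hmem)) v hv) (not_le.2 ?_)
    rwa [hst, ← ENNReal.ofReal_mul B.m_pos.le]
  have h0 : (0 : ℝ) ∈ Icc 0 T := ⟨le_rfl, hT⟩
  have hTT : T ∈ Icc 0 T := ⟨hT, le_rfl⟩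
  have hlt : T < τ := by
    by_contra! hle
    rcases hxy with hx | hy
    · refine hexp 0 τ le_rfl hle (sub_zero _) fun q hq =>
        key 0 h0 (by rwa [h.1.source]) q ⟨hq.1, hq.2.trans hle⟩ ?_
      rw [sub_zero, abs_of_nonneg hq.1]; exact hq.2
    · refine hexp (T - τ) T (by linarith) le_rfl (by ring) fun q hq =>
        key T hTT (by rwa [h.1.target]) q ⟨by linarith [hq.1], hq.2⟩ ?_
      rw [abs_of_nonpos (by linarith [hq.2])]; linarith [hq.1]
  refine ⟨hlt, fun t ht => ?_⟩
  rcases hxy with hx | hy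
  · refine key 0 h0 (by rwa [h.1.source]) t ht ?_
    rw [sub_zero, abs_of_nonneg ht.1]; linarith [ht.2]
  · refine key T hTT (by rwa [h.1.target]) t ht ?_
    rw [abs_of_nonpos (by linarith [ht.2])]; linarith [ht.1]

theorem norm_sub_le (B : S.HasLocalBounds y₀ e R M a m C r) (h : S.IsTrajectory x y T π)
    (hin : ∀ t ∈ Icc 0 T, π t ∈ Metric.ball y₀ R) {t : ℝ} (ht : t ∈ Icc 0 T) :
    ‖π t - x‖ ≤ M * t := by
  have := h.1.norm_sub_le le_rfl ht.1 ht.2 fun q hq v hv =>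
    B.speed_le _ (Metric.ball_subset_closedBall (hin q ⟨hq.1.le, hq.2.le.trans ht.2⟩)) v hv
  rwa [h.1.source, sub_zero] at this

theorem mul_le_inner (B : S.HasLocalBounds y₀ e R M a m C r) (h : S.IsTrajectory x y T π)
    (hin : ∀ t ∈ Icc 0 T, π t ∈ Metric.ball y₀ R) {t : ℝ} (ht : t ∈ Icc 0 T) :
    a * t ≤ innerSL ℝ e (π t - x) := by
  have := h.1.mul_sub_le le_rfl ht.1 ht.2 (innerSL ℝ e) fun q hq v hv =>
    B.le_drift _ (Metric.ball_subset_closedBall (hin q ⟨hq.1.le, hq.2.le.trans ht.2⟩)) v hv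
  rwa [h.1.source, sub_zero, ← map_sub] at this

/-- Near `y₀` the clearance is either large or comparable to the distance to `y₀`. -/
theorem clr_le [FiniteDimensional ℝ X] (B : S.HasLocalBounds y₀ e R M a m C r)
    (hS : S.StandingHypotheses) {ε τ : ℝ} (hε : ε ≤ R / 2) (hτ0 : 0 < τ) (hτ : τ ≤ R / (2 * M))
    (hτ' : τ * (2 * (a + M) ^ 2) ≤ r * a) (hx : x ∈ S.free) (hxε : ‖x - y₀‖ < ε)
    (hclr : S.clr x < ENNReal.ofReal (m * τ)) :
    S.clr x ≤ ENNReal.ofReal (C * (2 / a * ε)) := by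
  obtain ⟨y, hy, T, π, h, hcost⟩ := exists_trajectory_of_clr_lt hclr
  obtain ⟨hT, hin⟩ := B.time_lt h (Or.inl (hxε.trans_le hε)) hτ hcost
  obtain ⟨s, hs, hsf, hss⟩ := h.exists_first_hit hS hx hy
  have ha := B.a_pos
  have hM := B.M_pos
  have hr := B.r_pos
  -- After time `2ε/a` the drift outweighs the initial offset: the progress along `e` is at least `a
  -- s / 2` and the distance to `y₀` at most `(a + M) s`, which for `s < τ` puts the hit in the
  -- touching ball, at a shelf point.
  have hsε : s ≤ 2 / a * ε := by
    by_contra! hlt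
    refine hss (B.mem_shelf _ hsf ?_)
    have hεs : ε < a / 2 * s := by
      rw [div_mul_eq_mul_div, div_lt_iff₀ ha] at hlt
      linarith
    have hε0 : 0 < ε := (norm_nonneg _).trans_lt hxε
    have hs0 : 0 < s := by nlinarith
    have hdec : π s - y₀ = (π s - x) + (x - y₀) := by abel
    have h1 : ‖π s - y₀‖ ≤ (a + M) * s := by
      rw [hdec]
      refine (norm_add_le _ _).trans ?_
      have := B.norm_sub_le h hin hs
      nlinarith
    have h2 : a / 2 * s ≤ innerSL ℝ e (π s - y₀) := by
      rw [hdec, map_add]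
      have h3 := B.mul_le_inner h hin hs
      have h4 := (abs_le.1 (B.abs_inner_le (x - y₀))).1
      linarith
    calc ‖π s - y₀‖ ^ 2 ≤ ((a + M) * s) ^ 2 := by gcongr
      _ = (s * (a + M) ^ 2) * s := by ring
      _ ≤ (τ * (a + M) ^ 2) * s := by gcongr; linarith [hs.2]
      _ < (r * a) * s := by
        have : 0 < τ * (a + M) ^ 2 := by positivity
        exact mul_lt_mul_of_pos_right (by linarith) hs0
      _ = 2 * r * (a / 2 * s) := by ring
      _ ≤ 2 * r * innerSL ℝ e (π s - y₀) := by gcongr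
  have hsh := h.shift hS le_rfl hs.1 hs.2
  rw [h.1.source, sub_zero] at hsh
  refine (ControlSystem.clr_le hsh (hS.isClosed_obst.frontier_subset hsf)).trans
    ((trajectoryCost_le hsh.1 (C := C) fun t ht v hv => ?_).trans ?_)
  · refine B.cost_le _ (Metric.ball_subset_closedBall (hin _ ?_)) v hv
    rw [zero_add]
    exact ⟨ht.1, ht.2.trans hs.2⟩
  · rw [← ENNReal.ofReal_mul B.C_pos.le]
    exact ENNReal.ofReal_le_ofReal (mul_le_mul_of_nonneg_left hsε B.C_pos.le)

/-- Points reached cheaply from `y₀` have a large clearance. -/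
theorem le_clr [FiniteDimensional ℝ X] (B : S.HasLocalBounds y₀ e R M a m C r)
    (hS : S.StandingHypotheses) {τ : ℝ} (hτ0 : 0 < τ) (hτ : τ ≤ R / (2 * M))
    (hτ' : τ * (2 * (a + M) ^ 2) ≤ r * a) (hx : x ∈ S.free)
    (h : S.IsTrajectory y₀ x T π) (hcost : S.trajectoryCost T π < ENNReal.ofReal (m * τ))
    (hxR : ‖x - y₀‖ < R / 2) (hy₀ : y₀ ∈ S.obst) :
    ENNReal.ofReal (m * τ) ≤ S.clr x := by
  by_contra! hclr
  obtain ⟨y, hy, T', π', h', hcost'⟩ := exists_trajectory_of_clr_lt hclr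
  obtain ⟨hT, hin⟩ := B.time_lt h (Or.inr hxR) hτ hcost
  obtain ⟨hT', hin'⟩ := B.time_lt h' (Or.inl hxR) hτ hcost'
  obtain ⟨s, hs, hsf, hss⟩ := h'.exists_first_hit hS hx hy
  have ha := B.a_pos
  have hM := B.M_pos
  have hr := B.r_pos
  have hT0 : 0 < T := by
    rcases eq_or_lt_of_le h.1.time_nonneg with h0 | h0
    · refine absurd hy₀ ?_
      have := h.1.target
      rw [← h0, h.1.source] at this
      rwa [this]
    · exact h0
  have hTI : T ∈ Icc 0 T := ⟨hT0.le, le_rfl⟩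
  have h1 := B.norm_sub_le h hin hTI
  have h2 := B.mul_le_inner h hin hTI
  rw [h.1.target] at h1 h2
  have h3 := B.norm_sub_le h' hin' hs
  have h4 := B.mul_le_inner h' hin' hs
  have hdec : π' s - y₀ = (π' s - x) + (x - y₀) := by abel
  -- Followed one after the other, the two trajectories leave `y₀` itself, so there is no initial
  -- offset. The total time is below `2 * τ`, whence the factor `2` in `hτ'`.
  have h5 : ‖π' s - y₀‖ ≤ M * (s + T) := by
    rw [hdec]
    refine (norm_add_le _ _).trans ?_
    linarith
  have h6 : a * (s + T) ≤ innerSL ℝ e (π' s - y₀) := by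
    rw [hdec, map_add]
    linarith
  have hsT : 0 < s + T := by linarith [hs.1]
  refine hss (B.mem_shelf _ hsf ?_)
  calc ‖π' s - y₀‖ ^ 2 ≤ (M * (s + T)) ^ 2 := by gcongr
    _ = ((s + T) * M ^ 2) * (s + T) := by ring
    _ ≤ ((2 * τ) * (a + M) ^ 2) * (s + T) := by gcongr <;> linarith [hs.2]
    _ ≤ (r * a) * (s + T) := mul_le_mul_of_nonneg_right (by linarith) hsT.le
    _ < 2 * r * (a * (s + T)) := by
      have : 0 < r * a * (s + T) := by positivity
      linarith
    _ ≤ 2 * r * innerSL ℝ e (π' s - y₀) := by gcongr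

/-- Limits near `y₀` of points of small clearance have finite clearance. -/
theorem clr_lt_top_of_mem_closure [FiniteDimensional ℝ X]
    (B : S.HasLocalBounds y₀ e R M a m C r) (hS : S.StandingHypotheses) {τ ρ : ℝ}
    (hτ : τ ≤ R / (2 * M)) (hρ : ρ ≤ m * τ)
    (hx : x ∈ closure (S.wave ρ ∩ Metric.ball y₀ (R / 2))) : S.clr x < ⊤ := by
  have hex : ∀ z : ↥(S.wave ρ ∩ Metric.ball y₀ (R / 2)), ∃ y ∈ S.obst, ∃ T π,
      S.IsTrajectory z y T π ∧ S.trajectoryCost T π < ENNReal.ofReal (m * τ) := fun z =>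
    exists_trajectory_of_clr_lt (z.2.1.2.trans_le (ENNReal.ofReal_le_ofReal hρ))
  choose ys hys Ts πs h hcost using hex
  have hloc := fun z => B.time_lt (h z) (Or.inl (mem_ball_iff_norm.1 z.2.2)) hτ (hcost z)
  have hne := mem_closure_iff_comap_neBot.1 hx
  -- Along an ultrafilter converging to `x`, the short trajectories to the obstacle converge to a
  -- trajectory from `x` to the closed obstacle.
  set U := Ultrafilter.of (comap ((↑) : ↥(S.wave ρ ∩ Metric.ball y₀ (R / 2)) → X) (𝓝 x))
  obtain ⟨y, T, π, hy, hπ⟩ := exists_tendsto_isTrajectory hS U h (isCompact_closedBall y₀ R)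
    (fun z t ht => Metric.ball_subset_closedBall ((hloc z).2 t ht)) (fun z => (hloc z).1.le)
    (tendsto_comap.mono_left (Ultrafilter.of_le _))
  exact (ControlSystem.clr_le hπ (hS.isClosed_obst.mem_of_tendsto hy
    (Filter.Eventually.of_forall hys))).trans_lt (hπ.trajectoryCost_lt_top hS)

end HasLocalBounds

/-! ### Envelope points near the generator -/

/-- A point on two fronts has distinct first and last arrivals; finite clearance excludes the
convention that both are `⊤`. -/
theorem mem_envelope_of_mem_frontier_wave {ρ₁ ρ₂ : ℝ} (hx : x ∈ S.free) (hclr : S.clr x < ⊤)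
    (hρ₁ : 0 < ρ₁) (hρ : ρ₁ < ρ₂) (h₁ : x ∈ frontier (S.wave ρ₁))
    (h₂ : x ∈ frontier (S.wave ρ₂)) : x ∈ S.envelope ∧ S.rhoMin x ≤ ENNReal.ofReal ρ₁ := by
  have hmin : S.rhoMin x ≤ ENNReal.ofReal ρ₁ := by
    rw [rhoMin, if_neg hclr.ne]
    exact iInf_le_of_le ρ₁ (iInf₂_le hρ₁ h₁)
  have hmax : ENNReal.ofReal ρ₂ ≤ S.rhoMax x := by
    rw [rhoMax, if_neg hclr.ne]
    exact le_iSup_of_le ρ₂ (le_iSup₂_of_le (hρ₁.trans hρ) h₂ le_rfl)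
  exact ⟨⟨hx, hmin.trans_lt
    (((ENNReal.ofReal_lt_ofReal_iff (hρ₁.trans hρ)).2 hρ).trans_le hmax)⟩, hmin⟩

/-- Envelope points with a small first arrival time exist arbitrarily near `y₀`. -/
theorem exists_mem_envelope [FiniteDimensional ℝ X] (hS : S.StandingHypotheses)
    (hy₀ : y₀ ∈ frontier S.obst) (hH1 : S.H1 y₀) (hH2 : S.H2 y₀)
    (hForward : ∀ ρ : ℝ, 0 < ρ → (S.forwardReach ρ y₀ ∩ S.free).Nonempty)
    (hReverse : ∀ ρ : ℝ, 0 < ρ → (S.reverseReach ρ y₀ ∩ S.free).Nonempty) {ε : ℝ} (hε : 0 < ε) :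
    ∃ x ∈ S.envelope, dist x y₀ < ε ∧ S.rhoMin x ≤ ENNReal.ofReal ε := by
  obtain ⟨e, R, M, a, m, C, r, B⟩ := exists_hasLocalBounds hS hH1
  obtain ⟨r₀, hr₀, hconn⟩ := hH2
  have hy₀' : y₀ ∈ S.obst := hS.isClosed_obst.frontier_subset hy₀
  have hR := B.R_pos
  have hM := B.M_pos
  have ha := B.a_pos
  have hm := B.m_pos
  have hC := B.C_pos
  have hr := B.r_pos
  obtain ⟨τ, hτ0, hτ, hτ'⟩ : ∃ τ : ℝ, 0 < τ ∧ τ ≤ R / (2 * M) ∧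
      τ * (2 * (a + M) ^ 2) ≤ r * a := by
    refine ⟨min (R / (2 * M)) (r * a / (2 * (a + M) ^ 2)), by positivity, min_le_left _ _, ?_⟩
    rw [← le_div_iff₀ (by positivity)]
    exact min_le_right _ _
  -- The summand `1` turns the bound `C * (2 / a) * η` on small clearances into a strict one.
  set κ := C * (2 / a) + 1 with hκ
  have hκ0 : 0 < κ := by positivity
  obtain ⟨η, hη0, hηε, hηR, hηr, hηκ, hητ⟩ : ∃ η : ℝ, 0 < η ∧ η < ε ∧ η ≤ R / 2 ∧ η < r₀ ∧
      κ * η ≤ ε ∧ κ * η < m * τ := by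
    have hpos : 0 < min (min ε (R / 2)) (min r₀ (min (ε / κ) (m * τ / κ))) := by positivity
    obtain ⟨η, hη0, hη⟩ := exists_between hpos
    simp only [lt_min_iff, lt_div_iff₀ hκ0] at hη
    obtain ⟨⟨h1, h2⟩, h3, h4, h5⟩ := hη
    exact ⟨η, hη0, h1, h2.le, h3, by linarith, by linarith⟩
  have hsmall : ∀ x ∈ S.free, ‖x - y₀‖ < η → S.clr x < ENNReal.ofReal (m * τ) →
      S.clr x < ENNReal.ofReal (κ * η) := fun x hx hxη hlt => by
    refine (B.clr_le hS hηR hτ0 hτ hτ' hx hxη hlt).trans_lt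
      ((ENNReal.ofReal_lt_ofReal_iff (by positivity)).2 ?_)
    rw [hκ]
    linarith
  have hwave : S.wave (κ * η) ∩ Metric.ball y₀ η = S.wave (m * τ) ∩ Metric.ball y₀ η := by
    ext x
    refine ⟨fun ⟨⟨hx, hlt⟩, hb⟩ => ⟨⟨hx, hlt.trans_le (ENNReal.ofReal_le_ofReal hητ.le)⟩, hb⟩,
      fun ⟨⟨hx, hlt⟩, hb⟩ => ⟨⟨hx, hsmall x hx (mem_ball_iff_norm.1 hb) hlt⟩, hb⟩⟩
  -- a time so short that trajectories from or to `y₀` stay within distance `η`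
  obtain ⟨σ, hσ0, hση, hστ⟩ : ∃ σ : ℝ, 0 < σ ∧ M * σ ≤ η ∧ σ ≤ τ := by
    refine ⟨min (η / M) τ, by positivity, ?_, min_le_right _ _⟩
    rw [mul_comm, ← le_div_iff₀ hM]
    exact min_le_left _ _
  have hmσ : ENNReal.ofReal (m * σ) ≤ ENNReal.ofReal (m * τ) :=
    ENNReal.ofReal_le_ofReal (by gcongr)
  have hy₀R : ‖y₀ - y₀‖ < R / 2 := by rw [sub_self, norm_zero]; positivity
  have hin : (Metric.ball y₀ η ∩ S.free ∩ S.wave (κ * η)).Nonempty := by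
    obtain ⟨z, hz, hzf⟩ := hReverse (m * σ) (by positivity)
    obtain ⟨T, π, h, hcost⟩ := exists_trajectory_of_costDist_lt hz
    obtain ⟨hT, hloc⟩ := B.time_lt h (Or.inr hy₀R) (hστ.trans hτ) hcost
    have hzη : ‖z - y₀‖ < η := by
      have h1 := B.norm_sub_le h hloc (t := T) ⟨h.1.time_nonneg, le_rfl⟩
      rw [h.1.target, norm_sub_rev] at h1
      have h2 : M * T < M * σ := by gcongr
      linarith
    refine ⟨z, ⟨mem_ball_iff_norm.2 hzη, hzf⟩, hzf, hsmall z hzf hzη ?_⟩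
    exact ((clr_le h hy₀').trans_lt hcost).trans_le hmσ
  have hout : (Metric.ball y₀ η ∩ S.free ∩ (S.wave (κ * η))ᶜ).Nonempty := by
    obtain ⟨z, hz, hzf⟩ := hForward (m * σ) (by positivity)
    obtain ⟨T, π, h, hcost⟩ := exists_trajectory_of_costDist_lt hz
    obtain ⟨hT, hloc⟩ := B.time_lt h (Or.inl hy₀R) (hστ.trans hτ) hcost
    have hzη : ‖z - y₀‖ < η := by
      have h1 := B.norm_sub_le h hloc (t := T) ⟨h.1.time_nonneg, le_rfl⟩
      rw [h.1.target] at h1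
      have h2 : M * T < M * σ := by gcongr
      linarith
    refine ⟨z, ⟨mem_ball_iff_norm.2 hzη, hzf⟩, fun hw => ?_⟩
    have := B.le_clr hS hτ0 hτ hτ' hzf h (hcost.trans_le hmσ) (hzη.trans_le hηR) hy₀'
    exact absurd (hw.2.trans_le (ENNReal.ofReal_le_ofReal hητ.le)) (not_lt.2 this)
  obtain ⟨x, ⟨hxb, hxf⟩, hxw⟩ :=
    (hconn η hη0 hηr).isPreconnected.inter_frontier_nonempty hin hout
  -- The frontier is determined locally, and the two waves agree on the open ball.
  have hxw' : x ∈ frontier (S.wave (m * τ)) := by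
    have h1 : x ∈ frontier (S.wave (κ * η)) ∩ Metric.ball y₀ η := ⟨hxw, hxb⟩
    rw [← frontier_inter_open_inter Metric.isOpen_ball, hwave,
      frontier_inter_open_inter Metric.isOpen_ball] at h1
    exact h1.1
  have hclr : S.clr x < ⊤ := by
    refine B.clr_lt_top_of_mem_closure hS hτ hητ.le ?_
    exact closure_mono (inter_subset_inter_right _ (Metric.ball_subset_ball hηR))
      (Metric.isOpen_ball.closure_inter ⟨frontier_subset_closure hxw, hxb⟩)
  obtain ⟨henv, hmin⟩ :=
    mem_envelope_of_mem_frontier_wave hxf hclr (by positivity) hητ hxw hxw'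
  exact ⟨x, henv, (Metric.mem_ball.1 hxb).trans hηε, hmin.trans (ENNReal.ofReal_le_ofReal hηκ)⟩

end ControlSystem

theorem mainTheorem1 {X : Type*} [NormedAddCommGroup X] [InnerProductSpace ℝ X]
    [FiniteDimensional ℝ X] (S : ControlSystem X) (hS : S.StandingHypotheses)
    (y₀ : X) (hy₀ : y₀ ∈ frontier S.obst) (hH1 : S.H1 y₀) (hH2 : S.H2 y₀)
    (hForward : ∀ ρ : ℝ, 0 < ρ → (S.forwardReach ρ y₀ ∩ S.free).Nonempty)
    (hReverse : ∀ ρ : ℝ, 0 < ρ → (S.reverseReach ρ y₀ ∩ S.free).Nonempty) :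
    S.IsEnvelopeGenerator y₀ := by
  refine ⟨hy₀, ?_⟩
  have hpos : ∀ n : ℕ, (0 : ℝ) < 1 / ((n : ℝ) + 1) := fun n => by positivity
  choose x hx hdist hmin using fun n : ℕ =>
    ControlSystem.exists_mem_envelope hS hy₀ hH1 hH2 hForward hReverse (hpos n)
  have hlim := tendsto_one_div_add_atTop_nhds_zero_nat (𝕜 := ℝ)
  refine ⟨x, hx, ?_, ?_⟩
  · rw [tendsto_iff_dist_tendsto_zero]
    exact squeeze_zero (fun _ => dist_nonneg) (fun n => (hdist n).le) hlim
  · refine tendsto_of_tendsto_of_tendsto_of_le_of_le tendsto_const_nhds ?_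
      (fun _ => zero_le) hmin
    simpa using ENNReal.tendsto_ofReal hlim
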